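/- **Definitions.** Let $\mathcal G_2$ be the set of marked groups $(G,(a,b))$ on two generators, up to isomorphism of marked groups, with the topology of the ultrametric $d(G,H)=e^{-\lambda}$ for $G\neq H$, where $\lambda$ is the length of a shortest word of the free group $\mathbb F(a,b)$ that is trivial in exactly one of $G$ and $H$. For nonzero integers $m,n$ let $BS(m,n)=\langle a,b\mid ab^ma^{-1}=b^n\rangle\in\mathcal G_2$, marked by $(a,b)$. For $m\neq 0$ let $\mathbb Z_m=\varprojlim_h \mathbb Z/m^h\mathbb Z$ be the topological ring of $m$-adic integers (the zero ring if $|m|=1$), and let $\mathbb Z_m^\times$ be its set of invertible elements, with the subspace topology. For $\xi\in\mathbb Z_m$ let $\overline{BS}(m,\xi)=\lim_{k\to\infty}BS(m,\xi_k)$ in $\mathcal G_2$, where $(\xi_k)$ is any sequence of integers such that $\xi_k\to\xi$ in $\mathbb Z_m$ and $|\xi_k|\to\infty$. **Corollary 2.13.** Let $m\neq 0$ be an integer and let $X_m=\{BS(m,n) : n\in\mathbb Z\setminus\{0\},\ \gcd(m,n)=1\}\subset\mathcal G_2$. For every $\xi\in\mathbb Z_m^\times$ the limit $\overline{BS}(m,\xi)$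 exists and does not depend on the sequence. The boundary $\partial X_m$ of $X_m$ in $\mathcal G_2$, that is, its set of accumulation points, is equal to $\overline{X_m}\setminus X_m$ and to $\{\overline{BS}(m,\xi) : \xi\in\mathbb Z_m^\times\}$. Moreover, $\xi\mapsto\overline{BS}(m,\xi)$ is a homeomorphism from $\mathbb Z_m^\times$ onto $\partial X_m$. -/

import Mathlib

open Filter Topology

noncomputable section

/-- A marked group on `k` generators: a group together with a generating `k`-tuple.
Such a group is countable, so every one of them is isomorphic to one living in `Type`. -/
structure MarkedGroup (k : ℕ) : Type 1 where
  carrier : Type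
  [group : Group carrier]
  gen : Fin k → carrier
  closure_gen : Subgroup.closure (Set.range gen) = ⊤

attribute [instance] MarkedGroup.group

namespace MarkedGroup

variable {k : ℕ}

/-- The canonical homomorphism from the free group onto a marked group. -/
def proj (G : MarkedGroup k) : FreeGroup (Fin k) →* G.carrier :=
  FreeGroup.lift G.gen

theorem proj_surjective (G : MarkedGroup k) : Function.Surjective G.proj := by
  rw [← MonoidHom.range_eq_top, proj, FreeGroup.range_lift_eq_closure]
  exact G.closure_gen

/-- Isomorphism of marked groups: a group isomorphism respecting the markings. -/
def Iso (G H : MarkedGroup k) : Prop :=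
  ∃ e : G.carrier ≃* H.carrier, ∀ i, e (G.gen i) = H.gen i

instance isoSetoid (k : ℕ) : Setoid (MarkedGroup k) where
  r := Iso
  iseqv :=
    { refl := fun G => ⟨MulEquiv.refl _, fun _ => rfl⟩
      symm := by
        rintro G H ⟨e, he⟩
        exact ⟨e.symm, fun i => by rw [← he i, e.symm_apply_apply]⟩
      trans := by
        rintro G H K ⟨e, he⟩ ⟨f, hf⟩
        exact ⟨e.trans f, fun i => by rw [MulEquiv.trans_apply, he i, hf i]⟩ }

theorem Iso.ker_eq {G H : MarkedGroup k} (h : Iso G H) : G.proj.ker = H.proj.ker := by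
  obtain ⟨e, he⟩ := h
  have hc : e.toMonoidHom.comp G.proj = H.proj := by
    ext i
    simp [proj, he]
  ext w
  rw [MonoidHom.mem_ker, MonoidHom.mem_ker, ← hc]
  simp

theorem iso_of_ker_eq {G H : MarkedGroup k} (h : G.proj.ker = H.proj.ker) : Iso G H := by
  refine ⟨((QuotientGroup.quotientKerEquivOfSurjective G.proj G.proj_surjective).symm.trans
    (QuotientGroup.quotientMulEquivOfEq h)).trans
    (QuotientGroup.quotientKerEquivOfSurjective H.proj H.proj_surjective), fun i => ?_⟩
  have hG : (QuotientGroup.quotientKerEquivOfSurjective G.proj G.proj_surjective).symm (G.gen i)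
      = QuotientGroup.mk (FreeGroup.of i) := by
    rw [MulEquiv.symm_apply_eq]
    exact (FreeGroup.lift_apply_of (f := G.gen) (x := i)).symm
  rw [MulEquiv.trans_apply, MulEquiv.trans_apply, hG]
  exact FreeGroup.lift_apply_of (f := H.gen) (x := i)

/-- The group given by a presentation on `k` generators, marked by these generators. -/
def ofRels (R : Set (FreeGroup (Fin k))) : MarkedGroup k where
  carrier := PresentedGroup R
  gen := PresentedGroup.of
  closure_gen := PresentedGroup.closure_range_of R

end MarkedGroup

/-- The set `𝒢_k` of marked groups on `k` generators, up to isomorphism of marked groups. -/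
def MarkedGroupSpace (k : ℕ) : Type 1 := Quotient (MarkedGroup.isoSetoid k)

namespace MarkedGroupSpace

variable {k : ℕ}

instance : Nonempty (MarkedGroupSpace k) := ⟨Quotient.mk _ (MarkedGroup.ofRels ∅)⟩

/-- The normal subgroup of the words of the free group that vanish in a marked group. -/
def ker (G : MarkedGroupSpace k) : Subgroup (FreeGroup (Fin k)) :=
  Quotient.lift (fun G : MarkedGroup k => G.proj.ker) (fun _ _ h => MarkedGroup.Iso.ker_eq h) G

theorem ker_injective : Function.Injective (ker : MarkedGroupSpace k → _) := by
  intro G H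
  induction G using Quotient.inductionOn
  induction H using Quotient.inductionOn
  exact fun h => Quotient.sound (MarkedGroup.iso_of_ker_eq h)

/-- The words that vanish in exactly one of two marked groups. -/
def diffWords (G H : MarkedGroupSpace k) : Set (FreeGroup (Fin k)) :=
  {w | ¬(w ∈ G.ker ↔ w ∈ H.ker)}

/-- The length of a shortest word that vanishes in exactly one of two (distinct) marked groups. -/
def diffLength (G H : MarkedGroupSpace k) : ℕ :=
  sInf (FreeGroup.norm '' diffWords G H)

theorem diffWords_comm (G H : MarkedGroupSpace k) : diffWords G H = diffWords H G := by
  ext w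
  exact not_congr Iff.comm

theorem diffWords_nonempty {G H : MarkedGroupSpace k} (h : G ≠ H) : (diffWords G H).Nonempty := by
  by_contra hc
  rw [Set.not_nonempty_iff_eq_empty, Set.eq_empty_iff_forall_notMem] at hc
  refine h (ker_injective (SetLike.ext fun w => ?_))
  exact not_not.mp (hc w)

open Classical in
/-- The ultrametric `d(G, H) = exp (-λ)`, where `λ` is the length of a shortest word that vanishes
in one of the groups and not in the other one. -/
instance : MetricSpace (MarkedGroupSpace k) where
  dist G H := if G = H then 0 else Real.exp (-(diffLength G H : ℝ))
  dist_self G := by simp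
  dist_comm G H := by simp only [eq_comm, diffLength, diffWords_comm]
  dist_triangle G H K := by
    have hn : ∀ A B : MarkedGroupSpace k,
        0 ≤ (if A = B then 0 else Real.exp (-(diffLength A B : ℝ))) := fun A B => by
      split_ifs <;> positivity
    have key : ∀ (A B : MarkedGroupSpace k) (w : FreeGroup (Fin k)), w ∈ diffWords A B →
        Real.exp (-(w.norm : ℝ)) ≤ (if A = B then 0 else Real.exp (-(diffLength A B : ℝ))) := by
      intro A B w hw
      have hAB : A ≠ B := by
        rintro rfl
        exact hw Iff.rfl
      rw [if_neg hAB, Real.exp_le_exp, neg_le_neg_iff, Nat.cast_le]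
      exact Nat.sInf_le ⟨w, hw, rfl⟩
    by_cases hGK : G = K
    · rw [if_pos hGK]
      exact add_nonneg (hn _ _) (hn _ _)
    · obtain ⟨w, hw, hwn⟩ := Nat.sInf_mem ((diffWords_nonempty hGK).image FreeGroup.norm)
      have hE : (if G = K then 0 else Real.exp (-(diffLength G K : ℝ)))
          = Real.exp (-(w.norm : ℝ)) := by
        rw [if_neg hGK, hwn, diffLength]
      rw [hE]
      have hor : w ∈ diffWords G H ∨ w ∈ diffWords H K := by
        by_contra! hc
        exact hw ((not_not.mp hc.1).trans (not_not.mp hc.2))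
      rcases hor with h | h
      · exact (key _ _ w h).trans (le_add_of_nonneg_right (hn _ _))
      · exact (key _ _ w h).trans (le_add_of_nonneg_left (hn _ _))
  eq_of_dist_eq_zero {G H} h := by
    by_contra hne
    have h' : (if G = H then 0 else Real.exp (-(diffLength G H : ℝ))) = 0 := h
    rw [if_neg hne] at h'
    exact (Real.exp_pos _).ne' h'

end MarkedGroupSpace

/-- The compatible sequences in `∏ h, ℤ/m^hℤ`. -/
def adicSubring (m : ℤ) : Subring ((h : ℕ) → ZMod (m.natAbs ^ h)) where
  carrier := {x | ∀ h, ZMod.castHom (pow_dvd_pow m.natAbs h.le_succ) (ZMod (m.natAbs ^ h))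
    (x (h + 1)) = x h}
  mul_mem' {x y} hx hy h := by rw [Pi.mul_apply, map_mul, hx h, hy h, Pi.mul_apply]
  one_mem' h := map_one _
  add_mem' {x y} hx hy h := by rw [Pi.add_apply, map_add, hx h, hy h, Pi.add_apply]
  zero_mem' h := map_zero _
  neg_mem' {x} hx h := by rw [Pi.neg_apply, map_neg, hx h, Pi.neg_apply]

/-- The topological ring `ℤ_m` of `m`-adic integers: the projective limit of the discrete rings
`ℤ/m^hℤ`, with the topology induced by the product topology. -/
abbrev AdicInt (m : ℤ) : Type := adicSubring m

/-- The Baumslag-Solitar group `BS(m,n) = ⟨a, b | a b^m a⁻¹ = b^n⟩`, marked by `(a, b)`. -/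
def BS (m n : ℤ) : MarkedGroupSpace 2 :=
  Quotient.mk _ (MarkedGroup.ofRels
    {FreeGroup.of 0 * FreeGroup.of 1 ^ m * (FreeGroup.of 0)⁻¹ * (FreeGroup.of 1 ^ n)⁻¹})

/-- The filter on `ℤ` of "`n → ξ` in `ℤ_m` and `|n| → ∞`". -/
def adicInftyFilter (m : ℤ) (ξ : AdicInt m) : Filter ℤ :=
  comap (fun n : ℤ => (n : AdicInt m)) (𝓝 ξ) ⊓ comap (fun n : ℤ => |n|) atTop

/-- `BSbar m ξ` is the limit of the marked groups `BS(m,n)` as `n → ξ` in `ℤ_m` and `|n| → ∞`. -/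
def BSbar (m : ℤ) (ξ : AdicInt m) : MarkedGroupSpace 2 :=
  limUnder (adicInftyFilter m ξ) (BS m)

/-- The set of the marked groups `BS(m,n)` with `n ≠ 0` relatively prime to `m`. -/
def coprimeBS (m : ℤ) : Set (MarkedGroupSpace 2) :=
  {G | ∃ n : ℤ, n ≠ 0 ∧ IsCoprime m n ∧ G = BS m n}

end

/-!
A sequence of marked groups converges when every word is eventually trivial or eventually
nontrivial, so the question is how the word problem of `BS(m,n)` varies with `n`. The group `BS(m,n)`
is an HNN extension of `ℤ`, and Britton's lemma (`eq_nil_of_quot_eq_one`) says that a word is trivial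
only if it can be reduced to the empty word by the replacements `a b^{mk} a⁻¹ = b^{nk}` and
`a⁻¹ b^{nk} a = b^{mk}`.

Let `n` tend to a unit `ξ` of `ℤ_m` with `|n| → ∞`. Carry out the reduction for all `n` at once, with
exponents that are polynomials `f` in `n` over `ℤ[1/m]`. Whether `m ∣ f(n)` depends only on `n` modulo
a power of `m`, which is eventually constant; whether `n ∣ f(n)` is eventually equivalent to
`f(0) = 0`, since `n` is coprime to `m`; and `n f / m` and, if `f(0) = 0`, `m f / n` are again such
polynomials. Hence every step of the reduction is eventually the same for all `n`
(`exists_eventually_reduced`), and the limit exists (`exists_tendsto_BS`). The same argument makes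
`BSbar m` continuous on the units, which form a compact space, so it remains to see that `BSbar m` is
injective there and that its image is the boundary.

* Injectivity (`injOn_BSbar`): for `1 < |n|`, if `n ≡ r` modulo `m^h`, then `a^{h+1} b^{n-r} a^{-(h+1)}` commutes
  with `b` if and only if `n ≡ r` modulo `m^{h+1}`. As `b^n = a b^m a⁻¹`, this commutator is a word
  that does not depend on `n`.
* The relator of `BS(m,n)` is trivial in `BS(m,n')` only for `n' = n`, because `b` has infinite order.
  So no `BS(m,n)` is one of the limits (`BSbar_notMem_coprimeBS`).
* By compactness of `ℤ_m`, every accumulation point is one of the limits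
  (`exists_eq_BSbar_of_mem_derivedSet`).
-/

/-! ### Convergence in the space of marked groups -/

namespace MarkedGroupSpace

variable {k : ℕ}

theorem finite_norm_le (N : ℕ) : {w : FreeGroup (Fin k) | w.norm ≤ N}.Finite :=
  (List.finite_length_le (Fin k × Bool) N).preimage FreeGroup.toWord_injective.injOn

/-- Convergence of marked groups is the pointwise convergence of their word problems. -/
theorem tendsto_nhds_iff_eventually_mem_ker {α : Type*} {F : Filter α}
    {g : α → MarkedGroupSpace k} {G : MarkedGroupSpace k} :
    Tendsto g F (𝓝 G) ↔ ∀ w, ∀ᶠ x in F, (w ∈ (g x).ker ↔ w ∈ G.ker) := by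
  classical
  constructor
  · intro h w
    filter_upwards [Metric.tendsto_nhds.1 h _ (Real.exp_pos (-(w.norm : ℝ)))] with x hx
    by_contra hw
    have hne : g x ≠ G := by
      intro h
      rw [h] at hw
      exact hw Iff.rfl
    have hd : dist (g x) G = Real.exp (-(diffLength (g x) G : ℝ)) := if_neg hne
    rw [hd, Real.exp_lt_exp, neg_lt_neg_iff, Nat.cast_lt] at hx
    exact absurd hx (not_lt.2 (Nat.sInf_le ⟨w, hw, rfl⟩))
  · intro h
    rw [Metric.tendsto_nhds]
    intro ε hε
    obtain ⟨N, hN⟩ := exists_nat_gt (-Real.log ε)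
    filter_upwards [(finite_norm_le N).eventually_all.2 fun w _ => h w] with x hx
    by_cases hne : g x = G
    · rw [hne, dist_self]
      exact hε
    have hd : dist (g x) G = Real.exp (-(diffLength (g x) G : ℝ)) := if_neg hne
    obtain ⟨w, hw, hwn⟩ := Nat.sInf_mem ((diffWords_nonempty hne).image FreeGroup.norm)
    have hlt : N < diffLength (g x) G := by
      rw [diffLength, ← hwn]
      by_contra! hle
      exact hw (hx w hle)
    rw [hd, ← Real.lt_log_iff_exp_lt hε]
    have : (N : ℝ) < diffLength (g x) G := by exact_mod_cast hlt
    linarith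

theorem ker_normal (G : MarkedGroupSpace k) : G.ker.Normal := by
  induction G using Quotient.inductionOn with
  | h G => exact G.proj.normal_ker

theorem exists_ker_eq (N : Subgroup (FreeGroup (Fin k))) [hN : N.Normal] :
    ∃ G : MarkedGroupSpace k, G.ker = N := by
  refine ⟨Quotient.mk _ (MarkedGroup.ofRels (N : Set (FreeGroup (Fin k)))), ?_⟩
  have h : (MarkedGroup.ofRels (N : Set (FreeGroup (Fin k)))).proj
      = PresentedGroup.mk (N : Set (FreeGroup (Fin k))) := by
    ext i
    exact FreeGroup.lift_apply_of
  change (MarkedGroup.proj _).ker = N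
  rw [h]
  refine (QuotientGroup.ker_mk' _).trans ?_
  exact Subgroup.normalClosure_eq_self N

/-- A family of marked groups in which every word is eventually trivial or eventually nontrivial
converges: the eventually trivial words form the kernel of the limit. -/
theorem exists_tendsto_of_eventually_or {α : Type*} {F : Filter α} {g : α → MarkedGroupSpace k}
    (h : ∀ w, (∀ᶠ x in F, w ∈ (g x).ker) ∨ ∀ᶠ x in F, w ∉ (g x).ker) :
    ∃ G, Tendsto g F (𝓝 G) := by
  let N : Subgroup (FreeGroup (Fin k)) :=
    { carrier := {w | ∀ᶠ x in F, w ∈ (g x).ker}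
      one_mem' := Eventually.of_forall fun x => one_mem _
      mul_mem' := fun ha hb => (ha.and hb).mono fun x hx => mul_mem hx.1 hx.2
      inv_mem' := fun ha => ha.mono fun x hx => inv_mem hx }
  have hN : N.Normal := ⟨fun w hw v => hw.mono fun x hx => (ker_normal (g x)).conj_mem w hx v⟩
  obtain ⟨G, hG⟩ := exists_ker_eq N
  refine ⟨G, tendsto_nhds_iff_eventually_mem_ker.2 fun w => ?_⟩
  rw [hG]
  by_cases hw : w ∈ N
  · exact Eventually.mono hw fun x hx => iff_of_true hx hw
  · exact ((h w).resolve_left hw).mono fun x hx => iff_of_false hx hw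

end MarkedGroupSpace

/-! ### Words in two letters and Britton's lemma for `BS(m,n)` -/

namespace BaumslagSolitar

/-- The element `a ^ ε₁ * b ^ k₁ * a ^ ε₂ * b ^ k₂ * ⋯` of a group. -/
def alternating {G : Type*} [Group G] (a b : G) (L : List (ℤˣ × ℤ)) : G :=
  (L.map fun p => a ^ (p.1 : ℤ) * b ^ p.2).prod

theorem alternating_cons {G : Type*} [Group G] (a b : G) (u : ℤˣ) (k : ℤ) (L : List (ℤˣ × ℤ)) :
    alternating a b ((u, k) :: L) = a ^ (u : ℤ) * b ^ k * alternating a b L := by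
  simp [alternating]

theorem map_alternating {G H : Type*} [Group G] [Group H] (f : G →* H) (a b : G)
    (L : List (ℤˣ × ℤ)) : f (alternating a b L) = alternating (f a) (f b) L := by
  simp [alternating, map_list_prod, Function.comp_def]

/-- The words of the free group on `a, b` are the products `b ^ k * a ^ ε₁ * b ^ k₁ * ⋯`. -/
theorem exists_eq_zpow_mul_alternating (w : FreeGroup (Fin 2)) : ∃ (k : ℤ) (L : List (ℤˣ × ℤ)),
    w = FreeGroup.of 1 ^ k * alternating (FreeGroup.of 0) (FreeGroup.of 1) L := by
  rw [← FreeGroup.mk_toWord (x := w)]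
  induction w.toWord with
  | nil => exact ⟨0, [], by simp [alternating, FreeGroup.one_eq_mk]⟩
  | cons x l ih =>
    obtain ⟨k, L, ih⟩ := ih
    have hx : FreeGroup.mk (x :: l) = FreeGroup.mk [x] * FreeGroup.mk l := by
      rw [FreeGroup.mul_mk, List.singleton_append]
    rw [hx, ih]
    obtain ⟨i, s⟩ := x
    have hs : ∃ u : ℤˣ, FreeGroup.mk [(i, s)] = FreeGroup.of i ^ (u : ℤ) := by
      cases s
      · exact ⟨-1, by simp [FreeGroup.of, FreeGroup.invRev]⟩
      · exact ⟨1, by simp [FreeGroup.of]⟩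
    obtain ⟨u, hu⟩ := hs
    rw [hu]
    fin_cases i
    · exact ⟨0, (u, k) :: L, by simp [alternating_cons, mul_assoc]⟩
    · exact ⟨u + k, L, by simp [zpow_add, mul_assoc]⟩

/-- The exponents `k` for which `a ^ u * b ^ k * a ^ (-u)` is a power of `b` in `BS(m,n)` are the
multiples of `edge m n u`, that is, of `m` for `u = 1` and of `n` for `u = -1`. -/
def edge (m n : ℤ) (u : ℤˣ) : ℤ := if u = 1 then m else n

theorem edge_one (m n : ℤ) : edge m n 1 = m := rfl

theorem edge_neg_one (m n : ℤ) : edge m n (-1) = n := rfl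

/-- A pair `a, b` of elements of a group satisfying `a * b ^ m * a⁻¹ = b ^ n`. -/
def IsBSPair {G : Type*} [Group G] (m n : ℤ) (a b : G) : Prop := a * b ^ m * a⁻¹ = b ^ n

theorem IsBSPair.conj {G : Type*} [Group G] {m n : ℤ} {a b : G} (h : IsBSPair m n a b) (k : ℤ) :
    a * b ^ (m * k) * a⁻¹ = b ^ (n * k) := by
  rw [zpow_mul, zpow_mul, ← conj_zpow, h]

theorem IsBSPair.conj_zpow_edge {G : Type*} [Group G] {m n : ℤ} {a b : G} (h : IsBSPair m n a b)
    (u : ℤˣ) (k : ℤ) :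
    a ^ (u : ℤ) * b ^ (edge m n u * k) * a ^ ((-u : ℤˣ) : ℤ) = b ^ (edge m n (-u) * k) := by
  rcases Int.units_eq_one_or u with rfl | rfl
  · simpa [edge_one, edge_neg_one] using h.conj k
  · simp only [edge_neg_one, neg_neg, edge_one]
    rw [← h.conj k]
    simp [mul_assoc]

/-- The condition in Britton's lemma: no subword `a ^ u * b ^ k * a ^ (-u)` with
`edge m n u ∣ k`. -/
def NoPinch (m n : ℤ) (p q : ℤˣ × ℤ) : Prop := edge m n p.1 ∣ p.2 → p.1 = q.1

section HNN

variable {m n : ℤ}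

open Multiplicative

theorem zpowGroupHom_injective (hm : m ≠ 0) :
    Function.Injective (zpowGroupHom m : Multiplicative ℤ →* Multiplicative ℤ) := by
  intro x y h
  have : m * toAdd x = m * toAdd y := by simpa [mul_comm] using congrArg toAdd h
  exact toAdd.injective (mul_left_cancel₀ hm this)

theorem mem_range_zpowGroupHom {x : Multiplicative ℤ} :
    x ∈ (zpowGroupHom m : Multiplicative ℤ →* Multiplicative ℤ).range ↔ m ∣ toAdd x := by
  constructor
  · rintro ⟨y, rfl⟩
    exact ⟨toAdd y, by simp⟩
  · rintro ⟨y, hy⟩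
    exact ⟨ofAdd y, toAdd.injective (by simpa using hy.symm)⟩

/-- The isomorphism `m * k ↦ n * k` from `mℤ` onto `nℤ`. -/
noncomputable def rangeEquiv (hm : m ≠ 0) (hn : n ≠ 0) :
    (zpowGroupHom m : Multiplicative ℤ →* Multiplicative ℤ).range ≃*
      (zpowGroupHom n : Multiplicative ℤ →* Multiplicative ℤ).range :=
  (MonoidHom.ofInjective (zpowGroupHom_injective hm)).symm.trans
    (MonoidHom.ofInjective (zpowGroupHom_injective hn))

/-- Britton's lemma, for an HNN extension of `ℤ`: some group has a pair satisfying the relation of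
`BS(m,n)` in which no reduced word is trivial. -/
theorem exists_isBSPair_reduced (hm : m ≠ 0) (hn : n ≠ 0) :
    ∃ (G : Type) (_ : Group G) (a b : G), IsBSPair m n a b ∧
      ∀ (k : ℤ) (L : List (ℤˣ × ℤ)), L.IsChain (NoPinch m n) →
        b ^ k * alternating a b L = 1 → L = [] ∧ k = 0 := by
  let φ := rangeEquiv hm hn
  refine ⟨HNNExtension _ _ _ φ, inferInstance, HNNExtension.t, HNNExtension.of (ofAdd 1), ?_, ?_⟩
  · have h := HNNExtension.t_mul_of (φ := φ)
      (MonoidHom.ofInjective (zpowGroupHom_injective hm) (ofAdd 1))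
    have h2 : φ (MonoidHom.ofInjective (zpowGroupHom_injective hm) (ofAdd 1))
      = MonoidHom.ofInjective (zpowGroupHom_injective hn) (ofAdd 1) := by
      simp [φ, rangeEquiv]
    rw [h2, MonoidHom.ofInjective_apply, MonoidHom.ofInjective_apply, zpowGroupHom_apply,
      zpowGroupHom_apply, map_zpow, map_zpow] at h
    rw [IsBSPair, h, mul_inv_cancel_right]
  · intro k L hL h
    let w : HNNExtension.NormalWord.ReducedWord (Multiplicative ℤ)
        (zpowGroupHom m : Multiplicative ℤ →* Multiplicative ℤ).range
        (zpowGroupHom n : Multiplicative ℤ →* Multiplicative ℤ).range :=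
      { head := ofAdd k
        toList := L.map fun p => (p.1, ofAdd p.2)
        chain := by
          rw [List.isChain_map]
          refine hL.imp fun p q hpq hp => hpq ?_
          rcases Int.units_eq_one_or p.1 with h1 | h1
          · rw [h1] at hp ⊢
            exact mem_range_zpowGroupHom.1 hp
          · rw [h1] at hp ⊢
            exact mem_range_zpowGroupHom.1 hp }
    have hof : ∀ j : ℤ, (HNNExtension.of (ofAdd 1) : HNNExtension _ _ _ φ) ^ j
        = HNNExtension.of (ofAdd j) := fun j => by
      rw [← map_zpow, ← ofAdd_zsmul, smul_eq_mul, mul_one]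
    have hw : w.prod φ = 1 := by
      rw [← h]
      simp [HNNExtension.NormalWord.ReducedWord.prod, w, alternating, hof, Function.comp_def]
    have hnil : L = [] := List.map_eq_nil_iff.1
      (HNNExtension.ReducedWord.toList_eq_nil_of_mem_of_range φ w (hw ▸ one_mem _))
    subst hnil
    refine ⟨rfl, ?_⟩
    rw [hof, alternating, List.map_nil, List.prod_nil, mul_one] at h
    exact ofAdd.injective (HNNExtension.of_injective (φ := φ) (h.trans (map_one _).symm))

end HNN

/-- The quotient map from the free group onto `BS(m,n)`. -/
def quot (m n : ℤ) := PresentedGroup.mk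
  {FreeGroup.of (0 : Fin 2) * FreeGroup.of 1 ^ m * (FreeGroup.of 0)⁻¹ * (FreeGroup.of 1 ^ n)⁻¹}

theorem mem_ker_BS {m n : ℤ} {w : FreeGroup (Fin 2)} : w ∈ (BS m n).ker ↔ quot m n w = 1 := by
  have h : (MarkedGroup.ofRels {FreeGroup.of (0 : Fin 2) * FreeGroup.of 1 ^ m *
      (FreeGroup.of 0)⁻¹ * (FreeGroup.of 1 ^ n)⁻¹}).proj = quot m n := by
    ext i
    exact FreeGroup.lift_apply_of
  change w ∈ (MarkedGroup.proj _).ker ↔ _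
  rw [h]
  exact Iff.rfl

/-- The generators of `BS(m,n)` satisfy its relation. -/
theorem isBSPair_quot (m n : ℤ) :
    IsBSPair m n (quot m n (FreeGroup.of 0)) (quot m n (FreeGroup.of 1)) := by
  have h : quot m n (FreeGroup.of 0 * FreeGroup.of 1 ^ m * (FreeGroup.of 0)⁻¹ *
      (FreeGroup.of 1 ^ n)⁻¹) = 1 := PresentedGroup.one_of_mem rfl
  rwa [map_mul, map_inv, mul_inv_eq_one, map_mul, map_mul, map_zpow, map_inv, map_zpow] at h

theorem lift_eq_one_of_quot_eq_one {m n : ℤ} {G : Type*} [Group G] {a b : G}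
    (h : IsBSPair m n a b) {w : FreeGroup (Fin 2)} (hw : quot m n w = 1) :
    FreeGroup.lift ![a, b] w = 1 := by
  have hr : ∀ r ∈ ({FreeGroup.of (0 : Fin 2) * FreeGroup.of 1 ^ m * (FreeGroup.of 0)⁻¹ *
      (FreeGroup.of 1 ^ n)⁻¹} : Set (FreeGroup (Fin 2))), FreeGroup.lift ![a, b] r = 1 := by
    rintro r rfl
    simpa [mul_inv_eq_one, IsBSPair] using h
  have hc : (PresentedGroup.toGroup hr).comp (quot m n) = FreeGroup.lift ![a, b] := by
    ext i
    rw [FreeGroup.lift_apply_of]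
    exact PresentedGroup.toGroup.of hr
  rw [← hc, MonoidHom.comp_apply, hw, map_one]

/-- Britton's lemma in `BS(m,n)`. -/
theorem eq_nil_of_quot_eq_one {m n : ℤ} (hm : m ≠ 0) (hn : n ≠ 0) {k : ℤ} {L : List (ℤˣ × ℤ)}
    (hL : L.IsChain (NoPinch m n))
    (h : quot m n (FreeGroup.of 1) ^ k *
      alternating (quot m n (FreeGroup.of 0)) (quot m n (FreeGroup.of 1)) L = 1) :
    L = [] ∧ k = 0 := by
  obtain ⟨G, _, a, b, hab, hred⟩ := exists_isBSPair_reduced hm hn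
  rw [← map_zpow, ← map_alternating, ← map_mul] at h
  have h1 := lift_eq_one_of_quot_eq_one hab h
  rw [map_mul, map_zpow, map_alternating] at h1
  exact hred k L hL (by simpa using h1)

/-- The generator `b` of `BS(m,n)` has infinite order. -/
theorem quot_zpow_eq_one_iff {m n : ℤ} (hm : m ≠ 0) (hn : n ≠ 0) {k : ℤ} :
    quot m n (FreeGroup.of 1) ^ k = 1 ↔ k = 0 := by
  refine ⟨fun h => (eq_nil_of_quot_eq_one hm hn (L := []) List.isChain_nil ?_).2, ?_⟩
  · simpa [alternating] using h
  · rintro rfl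
    exact zpow_zero _

end BaumslagSolitar

/-! ### Exponents that are polynomial in `n` over `ℤ[1/m]` -/

namespace BaumslagSolitar

/-- The properties of the filter "`n → ξ` in `ℤ_m` and `|n| → ∞`", for a unit `ξ` of `ℤ_m`, on
which the convergence of `BS(m,n)` depends. -/
structure IsUnitLimitFilter (m : ℤ) (F : Filter ℤ) : Prop where
  eventually_isCoprime : ∀ᶠ n in F, IsCoprime m n
  exists_eventually_dvd_sub : ∀ h : ℕ, ∃ r : ℤ, ∀ᶠ n in F, m ^ h ∣ n - r
  tendsto_abs : Tendsto (fun n : ℤ => |n|) F atTop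

/-- The functions of `n` that agree eventually with a polynomial over `ℤ[1/m]`, written with a
common denominator `m ^ j`. -/
def IsEventuallyPoly (m : ℤ) (F : Filter ℤ) (f : ℤ → ℤ) : Prop :=
  ∃ (P : Polynomial ℤ) (j : ℕ), ∀ᶠ n in F, m ^ j * f n = P.eval n

namespace IsEventuallyPoly

variable {m : ℤ} {F : Filter ℤ} {f g : ℤ → ℤ}

theorem const (k : ℤ) : IsEventuallyPoly m F fun _ => k :=
  ⟨Polynomial.C k, 0, Eventually.of_forall fun n => by simp⟩

theorem add (hf : IsEventuallyPoly m F f) (hg : IsEventuallyPoly m F g) :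
    IsEventuallyPoly m F fun n => f n + g n := by
  obtain ⟨P, i, hP⟩ := hf
  obtain ⟨Q, j, hQ⟩ := hg
  refine ⟨Polynomial.C (m ^ j) * P + Polynomial.C (m ^ i) * Q, i + j, ?_⟩
  filter_upwards [hP, hQ] with n h1 h2
  rw [Polynomial.eval_add, Polynomial.eval_mul, Polynomial.eval_mul, Polynomial.eval_C,
    Polynomial.eval_C, ← h1, ← h2]
  ring

theorem eventually_eq_zero_or (hm : m ≠ 0) (hF : Tendsto (fun n : ℤ => |n|) F atTop)
    (hf : IsEventuallyPoly m F f) : (∀ᶠ n in F, f n = 0) ∨ ∀ᶠ n in F, f n ≠ 0 := by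
  obtain ⟨P, j, hP⟩ := hf
  by_cases h0 : P = 0
  · left
    filter_upwards [hP] with n hn
    rw [h0, Polynomial.eval_zero] at hn
    exact (mul_eq_zero.1 hn).resolve_left (pow_ne_zero _ hm)
  · right
    have hroots : ∀ᶠ n in F, ∀ r ∈ P.roots.toFinset, n ≠ r := by
      refine (Filter.eventually_all_finset _).2 fun r _ => ?_
      filter_upwards [hF.eventually_gt_atTop |r|] with n hn hnr
      rw [hnr] at hn
      exact lt_irrefl _ hn
    filter_upwards [hP, hroots] with n hn hr h
    rw [h, mul_zero] at hn
    exact hr n (by simp [h0, ← hn]) rfl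

theorem eventually_left_dvd_or (hm : m ≠ 0) (hF : IsUnitLimitFilter m F)
    (hf : IsEventuallyPoly m F f) : (∀ᶠ n in F, m ∣ f n) ∨ ∀ᶠ n in F, ¬ m ∣ f n := by
  obtain ⟨P, j, hP⟩ := hf
  obtain ⟨r, hr⟩ := hF.exists_eventually_dvd_sub (j + 1)
  have key : ∀ᶠ n in F, (m ∣ f n ↔ m ^ (j + 1) ∣ P.eval r) := by
    filter_upwards [hP, hr] with n h1 h2
    rw [← dvd_iff_dvd_of_dvd_sub (h2.trans (P.sub_dvd_eval_sub n r)), ← h1, pow_succ,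
      mul_dvd_mul_iff_left (pow_ne_zero _ hm)]
  by_cases h : m ^ (j + 1) ∣ P.eval r
  · exact Or.inl (key.mono fun n hn => hn.2 h)
  · exact Or.inr (key.mono fun n hn => mt hn.1 h)

/-- If `P` represents `f`, then `n ∣ f n` holds eventually if `P 0 = 0`, because `n` is coprime
to the denominator, and fails eventually otherwise, because `n` would divide `P 0`. -/
theorem eventually_right_dvd_or (hF : IsUnitLimitFilter m F) {P : Polynomial ℤ} {j : ℕ}
    (hP : ∀ᶠ n in F, m ^ j * f n = P.eval n) :
    (P.coeff 0 = 0 ∧ ∀ᶠ n in F, n ∣ f n) ∨ (P.coeff 0 ≠ 0 ∧ ∀ᶠ n in F, ¬ n ∣ f n) := by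
  have hmod : ∀ n : ℤ, n ∣ P.eval n - P.coeff 0 := fun n => by
    simpa [Polynomial.coeff_zero_eq_eval_zero] using P.sub_dvd_eval_sub n 0
  by_cases h0 : P.coeff 0 = 0
  · refine Or.inl ⟨h0, ?_⟩
    filter_upwards [hP, hF.eventually_isCoprime] with n h1 h2
    refine (h2.symm.pow_right (n := j)).dvd_of_dvd_mul_left ?_
    rw [h1]
    simpa [h0] using hmod n
  · refine Or.inr ⟨h0, ?_⟩
    filter_upwards [hP, hF.tendsto_abs.eventually_gt_atTop |P.coeff 0|] with n h1 h2 h3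
    refine h0 (Int.eq_zero_of_abs_lt_dvd
      ((abs_dvd _ _).2 ((dvd_iff_dvd_of_dvd_sub (hmod n)).1 ?_)) h2)
    exact h1 ▸ h3.mul_left _

theorem eventually_edge_dvd_or (hm : m ≠ 0) (hF : IsUnitLimitFilter m F)
    (hf : IsEventuallyPoly m F f) (u : ℤˣ) :
    (∀ᶠ n in F, edge m n u ∣ f n) ∨ ∀ᶠ n in F, ¬ edge m n u ∣ f n := by
  rcases Int.units_eq_one_or u with rfl | rfl
  · exact hf.eventually_left_dvd_or hm hF
  · obtain ⟨P, j, hP⟩ := hf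
    exact (eventually_right_dvd_or hF hP).imp And.right And.right

/-- Conjugation by `a ^ u` preserves the exponents that are polynomials over `ℤ[1/m]`. -/
theorem edge_mul_div [F.NeBot] (hm : m ≠ 0) (hF : IsUnitLimitFilter m F)
    (hf : IsEventuallyPoly m F f) {u : ℤˣ} (h : ∀ᶠ n in F, edge m n u ∣ f n) :
    IsEventuallyPoly m F fun n => edge m n (-u) * (f n / edge m n u) := by
  obtain ⟨P, j, hP⟩ := hf
  rcases Int.units_eq_one_or u with rfl | rfl
  · refine ⟨Polynomial.X * P, j + 1, ?_⟩
    filter_upwards [hP, h] with n h1 h2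
    rw [edge_one] at h2 ⊢
    obtain ⟨c, hc⟩ := h2
    rw [edge_neg_one, Polynomial.eval_mul, Polynomial.eval_X, ← h1, hc,
      Int.mul_ediv_cancel_left _ hm]
    ring
  · have h0 : P.coeff 0 = 0 := by
      by_contra h0
      rcases eventually_right_dvd_or hF hP with h1 | h1
      · exact h0 h1.1
      · obtain ⟨n, h2, h3⟩ := (h.and h1.2).exists
        exact h3 h2
    refine ⟨Polynomial.C m * P.divX, j, ?_⟩
    filter_upwards [hP, h, hF.tendsto_abs.eventually_gt_atTop 0] with n h1 h2 h3
    rw [edge_neg_one] at h2 ⊢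
    obtain ⟨c, hc⟩ := h2
    have hn : n ≠ 0 := abs_pos.1 h3
    rw [← P.divX_mul_X_add, h0, hc] at h1
    rw [neg_neg, edge_one, hc, Int.mul_ediv_cancel_left _ hn, Polynomial.eval_mul,
      Polynomial.eval_C]
    refine mul_left_cancel₀ hn ?_
    simp only [map_zero, add_zero, Polynomial.eval_mul, Polynomial.eval_X] at h1
    linear_combination m * h1

end IsEventuallyPoly

/-! ### Britton reduction along a filter -/

section Reduction

variable {m : ℤ} {F : Filter ℤ}

/-- The value at `n` of a list of exponents depending on `n`. -/
def evalAt (n : ℤ) (L : List (ℤˣ × (ℤ → ℤ))) : List (ℤˣ × ℤ) := L.map fun p => (p.1, p.2 n)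

/-- Britton's condition, along a filter. -/
def EventuallyNoPinch (m : ℤ) (F : Filter ℤ) (p q : ℤˣ × (ℤ → ℤ)) : Prop :=
  p.1 = q.1 ∨ ∀ᶠ n in F, ¬ edge m n p.1 ∣ p.2 n

theorem eventually_isChain_evalAt {L : List (ℤˣ × (ℤ → ℤ))}
    (hL : L.IsChain (EventuallyNoPinch m F)) :
    ∀ᶠ n in F, (evalAt n L).IsChain (NoPinch m n) := by
  induction L with
  | nil => exact Eventually.of_forall fun n => List.isChain_nil
  | cons p L ih =>
    cases L with
    | nil => exact Eventually.of_forall fun n => List.isChain_singleton _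
    | cons q L =>
      rw [List.isChain_cons_cons] at hL
      rcases hL.1 with h | h
      · filter_upwards [ih hL.2] with n hn
        exact List.isChain_cons_cons.2 ⟨fun _ => h, hn⟩
      · filter_upwards [ih hL.2, h] with n hn h1
        exact List.isChain_cons_cons.2 ⟨fun h2 => absurd h2 h1, hn⟩

/-- Britton reduction, uniformly along a filter: a word whose exponents are polynomials in `n` over
`ℤ[1/m]` agrees in `BS(m,n)`, for eventually all `n`, with such a word that is reduced. -/
theorem exists_eventually_reduced [F.NeBot] (hm : m ≠ 0) (hF : IsUnitLimitFilter m F)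
    (L : List (ℤˣ × (ℤ → ℤ))) (hL : ∀ p ∈ L, IsEventuallyPoly m F p.2)
    (f : ℤ → ℤ) (hf : IsEventuallyPoly m F f) :
    ∃ (f' : ℤ → ℤ) (L' : List (ℤˣ × (ℤ → ℤ))), IsEventuallyPoly m F f' ∧
      (∀ p ∈ L', IsEventuallyPoly m F p.2) ∧ L'.IsChain (EventuallyNoPinch m F) ∧
      ∀ᶠ n in F, ∀ {G : Type} [Group G] {a b : G}, IsBSPair m n a b →
        b ^ f n * alternating a b (evalAt n L) = b ^ f' n * alternating a b (evalAt n L') := by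
  induction L generalizing f with
  | nil =>
    exact ⟨f, [], hf, hL, List.isChain_nil, Eventually.of_forall fun n _ _ _ _ _ => rfl⟩
  | cons p L ih =>
    obtain ⟨u, g⟩ := p
    obtain ⟨g', L', hg', hL', hc, heq⟩ := ih (fun p hp => hL p (List.mem_cons_of_mem _ hp)) g
      (hL (u, g) List.mem_cons_self)
    have heq' : ∀ᶠ n in F, ∀ {G : Type} [Group G] {a b : G}, IsBSPair m n a b →
        b ^ f n * alternating a b (evalAt n ((u, g) :: L))
          = b ^ f n * alternating a b (evalAt n ((u, g') :: L')) := by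
      filter_upwards [heq] with n hn G _ a b hab
      have := hn hab
      simp only [evalAt, List.map_cons, alternating_cons, mul_assoc] at this ⊢
      rw [this]
    have hall : ∀ p ∈ (u, g') :: L', IsEventuallyPoly m F p.2 := by
      intro p hp
      rcases List.mem_cons.1 hp with rfl | hp
      · exact hg'
      · exact hL' p hp
    -- Only the first two letters of `(u, g') :: L'` can form a pinch, since `L'` is reduced.
    cases L' with
    | nil => exact ⟨f, [(u, g')], hf, hall, List.isChain_singleton _, heq'⟩
    | cons q L'' =>
      obtain ⟨v, e⟩ := q
      by_cases huv : u = v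
      · exact ⟨f, (u, g') :: (v, e) :: L'', hf, hall,
          List.isChain_cons_cons.2 ⟨Or.inl huv, hc⟩, heq'⟩
      rcases hg'.eventually_edge_dvd_or hm hF u with hd | hd
      · obtain rfl : v = -u := by
          rcases Int.units_eq_one_or u with rfl | rfl <;>
            rcases Int.units_eq_one_or v with rfl | rfl <;> simp_all
        have he : IsEventuallyPoly m F e := hL' (-u, e) List.mem_cons_self
        refine ⟨fun n => f n + edge m n (-u) * (g' n / edge m n u) + e n, L'',
          (hf.add (hg'.edge_mul_div hm hF hd)).add he,
          fun p hp => hL' p (List.mem_cons_of_mem _ hp), (List.isChain_cons.1 hc).2, ?_⟩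
        filter_upwards [heq', hd] with n hn hdn G _ a b hab
        rw [hn hab]
        have hconj := hab.conj_zpow_edge u (g' n / edge m n u)
        rw [Int.mul_ediv_cancel' hdn] at hconj
        simp only [evalAt, List.map_cons, alternating_cons]
        rw [zpow_add, zpow_add, ← hconj]
        simp only [mul_assoc]
      · exact ⟨f, (u, g') :: (v, e) :: L'', hf, hall,
          List.isChain_cons_cons.2 ⟨Or.inr hd, hc⟩, heq'⟩

/-- Along a filter as above, every word is eventually trivial or eventually nontrivial in
`BS(m,n)`. -/
theorem eventually_mem_ker_BS_or [F.NeBot] (hm : m ≠ 0) (hF : IsUnitLimitFilter m F)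
    (w : FreeGroup (Fin 2)) :
    (∀ᶠ n in F, w ∈ (BS m n).ker) ∨ ∀ᶠ n in F, w ∉ (BS m n).ker := by
  obtain ⟨k, L, rfl⟩ := exists_eq_zpow_mul_alternating w
  obtain ⟨f, L', hf, -, hc, heq⟩ := exists_eventually_reduced hm hF
    (L.map fun p => (p.1, fun _ => p.2)) (by
      intro p hp
      obtain ⟨q, -, rfl⟩ := List.mem_map.1 hp
      exact IsEventuallyPoly.const q.2) (fun _ => k) (IsEventuallyPoly.const k)
  have hconst : ∀ n, evalAt n (L.map fun p => (p.1, fun _ => p.2)) = L := fun n => by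
    simp [evalAt, Function.comp_def]
  have key : ∀ᶠ n in F, (FreeGroup.of 1 ^ k * alternating (FreeGroup.of 0) (FreeGroup.of 1) L ∈
      (BS m n).ker ↔ quot m n (FreeGroup.of 1) ^ f n * alternating (quot m n (FreeGroup.of 0))
        (quot m n (FreeGroup.of 1)) (evalAt n L') = 1) := by
    filter_upwards [heq] with n hn
    rw [mem_ker_BS, map_mul, map_zpow, map_alternating, ← hn (isBSPair_quot m n), hconst]
  have hne : ∀ᶠ n in F, n ≠ 0 :=
    (hF.tendsto_abs.eventually_gt_atTop 0).mono fun n hn => abs_pos.1 hn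
  cases L' with
  | nil =>
    have hk : ∀ᶠ n in F, (FreeGroup.of 1 ^ k * alternating (FreeGroup.of 0) (FreeGroup.of 1) L ∈
        (BS m n).ker ↔ f n = 0) := by
      filter_upwards [key, hne] with n h1 h2
      rw [h1, ← quot_zpow_eq_one_iff hm h2]
      simp [evalAt, alternating]
    rcases hf.eventually_eq_zero_or hm hF.tendsto_abs with h0 | h0
    · exact Or.inl ((hk.and h0).mono fun n hn => hn.1.2 hn.2)
    · exact Or.inr ((hk.and h0).mono fun n hn => mt hn.1.1 hn.2)
  | cons p L' =>
    right
    filter_upwards [key, hne, eventually_isChain_evalAt hc] with n h1 h2 h3 h4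
    exact List.cons_ne_nil _ _ (eq_nil_of_quot_eq_one hm h2 h3 (h1.1 h4)).1

/-- `BS(m,n)` converges as `n` tends to a unit of `ℤ_m` and `|n|` tends to infinity. -/
theorem exists_tendsto_BS [F.NeBot] (hm : m ≠ 0) (hF : IsUnitLimitFilter m F) :
    ∃ G, Tendsto (BS m) F (𝓝 G) :=
  MarkedGroupSpace.exists_tendsto_of_eventually_or (eventually_mem_ker_BS_or hm hF)

end Reduction

/-! ### Words separating Baumslag-Solitar groups -/

/-- `BS(m,n)` is the only `BS(m,n')` with `n' ≠ 0` in which `a * b ^ m * a⁻¹ = b ^ n` holds. -/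
theorem relator_mem_ker_BS_iff {m n n' : ℤ} (hm : m ≠ 0) (hn' : n' ≠ 0) :
    FreeGroup.of 0 * FreeGroup.of 1 ^ m * (FreeGroup.of 0)⁻¹ * (FreeGroup.of 1 ^ n)⁻¹ ∈
      (BS m n').ker ↔ n = n' := by
  rw [mem_ker_BS, map_mul, map_inv, mul_inv_eq_one, map_mul, map_mul, map_zpow, map_inv, map_zpow,
    isBSPair_quot m n', ← mul_inv_eq_one, ← zpow_sub (quot m n' (FreeGroup.of 1)), quot_zpow_eq_one_iff hm hn']
  omega

theorem eventually_eq_of_tendsto_BS {α : Type*} {F : Filter α} {m n : ℤ} (hm : m ≠ 0) (hn : n ≠ 0)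
    {u : α → ℤ} (hu : ∀ᶠ x in F, u x ≠ 0) (h : Tendsto (fun x => BS m (u x)) F (𝓝 (BS m n))) :
    ∀ᶠ x in F, u x = n := by
  filter_upwards [hu, MarkedGroupSpace.tendsto_nhds_iff_eventually_mem_ker.1 h
    (FreeGroup.of 0 * FreeGroup.of 1 ^ m * (FreeGroup.of 0)⁻¹ * (FreeGroup.of 1 ^ n)⁻¹)] with x h1 h2
  rw [relator_mem_ker_BS_iff hm h1, relator_mem_ker_BS_iff hm hn] at h2
  exact (h2.2 rfl).symm

/-- The word `a ^ (h + 1) * b ^ (n - r) * a ^ (-(h + 1))` of `BS(m,n)`, with `b ^ n` written as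
`a * b ^ m * a⁻¹`. -/
def congruenceConj (m r : ℤ) (h : ℕ) : FreeGroup (Fin 2) :=
  FreeGroup.of 0 ^ (h + 1) * (FreeGroup.of 0 * FreeGroup.of 1 ^ m * (FreeGroup.of 0)⁻¹ *
    FreeGroup.of 1 ^ (-r)) * (FreeGroup.of 0 ^ (h + 1))⁻¹

/-- The commutator of `congruenceConj m r h` and `b`. When `n ≡ r` modulo `m ^ h`, conjugating
`b ^ (n - r)` by `a ^ h` gives a power of `b`, and one more conjugation by `a` gives a power of `b`
if and only if `n ≡ r` modulo `m ^ (h + 1)`. So, for `n` coprime to `m` with `1 < |n|`, this word is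
trivial in `BS(m,n)` exactly in the latter case. -/
def congruenceWord (m r : ℤ) (h : ℕ) : FreeGroup (Fin 2) :=
  congruenceConj m r h * FreeGroup.of 1 * (congruenceConj m r h)⁻¹ * (FreeGroup.of 1)⁻¹

/-- The divisibility by `m` needed at each of the `h` conjugations is provided by `m ^ h`. -/
theorem IsBSPair.pow_conj {G : Type*} [Group G] {m n : ℤ} {a b : G} (hab : IsBSPair m n a b)
    (h : ℕ) (c : ℤ) : a ^ h * b ^ (m ^ h * c) * (a ^ h)⁻¹ = b ^ (n ^ h * c) := by
  induction h generalizing c with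
  | zero => simp
  | succ h ih =>
    have h1 : m ^ (h + 1) * c = m ^ h * (m * c) := by ring
    have h2 : n ^ (h + 1) * c = n * (n ^ h * c) := by ring
    have h3 : n ^ h * (m * c) = m * (n ^ h * c) := by ring
    have h4 := ih (m * c)
    rw [h1, h2, ← hab.conj, ← h3, ← h4, pow_succ']
    group

theorem quot_congruenceConj (m n r : ℤ) {h : ℕ} {c : ℤ} (hr : n - r = m ^ h * c) :
    quot m n (congruenceConj m r h) = quot m n (FreeGroup.of 0) *
      quot m n (FreeGroup.of 1) ^ (n ^ h * c) * (quot m n (FreeGroup.of 0))⁻¹ := by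
  have hab := isBSPair_quot m n
  simp only [congruenceConj, map_mul, map_inv, map_pow, map_zpow]
  rw [hab, ← zpow_add, ← sub_eq_add_neg, hr, ← hab.pow_conj, pow_succ']
  group

theorem congruenceWord_mem_ker_BS {m n r : ℤ} {h : ℕ} (hr : m ^ (h + 1) ∣ n - r) :
    congruenceWord m r h ∈ (BS m n).ker := by
  obtain ⟨c, hc⟩ := hr
  have h1 : n ^ h * (m * c) = m * (n ^ h * c) := by ring
  rw [mem_ker_BS, congruenceWord, map_mul, map_mul, map_mul, map_inv, map_inv,
    quot_congruenceConj m n r (c := m * c) (by rw [hc]; ring), h1, (isBSPair_quot m n).conj]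
  group

theorem congruenceWord_notMem_ker_BS {m n r : ℤ} {h : ℕ} (hm : m ≠ 0) (hn : 1 < |n|)
    (hmn : IsCoprime m n) (hr : m ^ h ∣ n - r) (hr' : ¬ m ^ (h + 1) ∣ n - r) :
    congruenceWord m r h ∉ (BS m n).ker := by
  obtain ⟨c, hc⟩ := hr
  have hn0 : n ≠ 0 := by
    rintro rfl
    simp at hn
  have hmc : ¬ m ∣ n ^ h * c := fun hd => hr' <| by
    rw [hc, pow_succ]
    exact mul_dvd_mul_left _ ((hmn.pow_right (n := h)).dvd_of_dvd_mul_left hd)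
  have hn1 : ¬ n ∣ 1 := fun hd => by
    rw [← abs_dvd] at hd
    exact absurd (Int.le_of_dvd one_pos hd) (not_le.2 hn)
  rw [mem_ker_BS, congruenceWord, map_mul, map_mul, map_mul, map_inv, map_inv,
    quot_congruenceConj m n r hc]
  intro h1
  -- The two inner conditions `¬ n ∣ ±1` and `¬ m ∣ ± n ^ h * c` make the commutator reduced.
  have hL : List.IsChain (NoPinch m n)
      [((1 : ℤˣ), n ^ h * c), (-1, 1), (1, -(n ^ h * c)), (-1, -1)] := by
    simp [NoPinch, edge, hmc, hn1]
  refine List.cons_ne_nil _ _ (eq_nil_of_quot_eq_one hm hn0 (k := 0) hL ?_).1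
  rw [← h1]
  simp only [alternating, List.map_cons, List.map_nil, List.prod_cons, List.prod_nil, Units.val_one,
    Units.val_neg]
  group

end BaumslagSolitar

/-! ### The ring of `m`-adic integers -/

namespace AdicInt

variable {m : ℤ}

theorem intCast_zmod_eq_iff {n r : ℤ} {h : ℕ} :
    (n : ZMod (m.natAbs ^ h)) = r ↔ m ^ h ∣ n - r := by
  rw [eq_comm, ZMod.intCast_eq_intCast_iff_dvd_sub, Nat.cast_pow, Int.natCast_natAbs, ← abs_pow,
    abs_dvd]

theorem exists_intCast_eq (hm : m ≠ 0) (ξ : AdicInt m) (h : ℕ) :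
    ∃ r : ℕ, ((r : ℤ) : ZMod (m.natAbs ^ h)) = ξ.1 h := by
  have : NeZero (m.natAbs ^ h) := ⟨pow_ne_zero _ (Int.natAbs_ne_zero.2 hm)⟩
  exact ⟨(ξ.1 h).val, by simp⟩

theorem castHom_val (ξ : AdicInt m) {i j : ℕ} (hij : i ≤ j) :
    ZMod.castHom (pow_dvd_pow m.natAbs hij) (ZMod (m.natAbs ^ i)) (ξ.1 j) = ξ.1 i := by
  induction j, hij using Nat.le_induction with
  | base => simp
  | succ j hij ih =>
    rw [← ih, ← ξ.2 j, ← RingHom.comp_apply, ZMod.castHom_comp]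

theorem tendsto_intCast_iff {α : Type*} {F : Filter α} {u : α → ℤ} {ξ : AdicInt m} :
    Tendsto (fun x => (u x : AdicInt m)) F (𝓝 ξ) ↔
      ∀ h, ∀ᶠ x in F, (u x : ZMod (m.natAbs ^ h)) = ξ.1 h := by
  rw [tendsto_subtype_rng, tendsto_pi_nhds]
  simp only [nhds_discrete, tendsto_pure]
  rfl

theorem isUnit_iff {ξ : AdicInt m} : IsUnit ξ ↔ ∀ h, IsUnit (ξ.1 h) := by
  constructor
  · intro hξ h
    exact hξ.map ((Pi.evalRingHom _ h).comp (adicSubring m).subtype)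
  · intro hξ
    have hmul : ∀ h, ξ.1 h * (ξ.1 h)⁻¹ = 1 := fun h => ZMod.mul_inv_of_unit _ (hξ h)
    refine IsUnit.of_mul_eq_one ⟨fun h => (ξ.1 h)⁻¹, fun h => ?_⟩ (Subtype.ext (funext hmul))
    refine (hξ h).mul_left_cancel ?_
    rw [hmul, ← ξ.2 h, ← map_mul, hmul, map_one]

theorem isUnit_of_tendsto {α : Type*} {F : Filter α} [F.NeBot] {u : α → ℤ} {ξ : AdicInt m}
    (hu : ∀ᶠ x in F, IsCoprime m (u x)) (h : Tendsto (fun x => (u x : AdicInt m)) F (𝓝 ξ)) :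
    IsUnit ξ := by
  refine isUnit_iff.2 fun i => ?_
  obtain ⟨x, hx, hx'⟩ := (hu.and (tendsto_intCast_iff.1 h i)).exists
  rw [← hx', ZMod.coe_int_isUnit_iff_isCoprime, Nat.cast_pow, Int.natCast_natAbs]
  exact ((IsCoprime.abs_left_iff _ _).2 hx).pow_left

theorem compactSpace (hm : m ≠ 0) : CompactSpace (AdicInt m) := by
  have : ∀ h, NeZero (m.natAbs ^ h) := fun h => ⟨pow_ne_zero _ (Int.natAbs_ne_zero.2 hm)⟩
  refine isCompact_iff_compactSpace.1 (IsClosed.isCompact ?_)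
  change IsClosed {x : (h : ℕ) → ZMod (m.natAbs ^ h) | ∀ h, ZMod.castHom
    (pow_dvd_pow m.natAbs h.le_succ) (ZMod (m.natAbs ^ h)) (x (h + 1)) = x h}
  rw [Set.ofPred_forall]
  exact isClosed_iInter fun h => isClosed_eq
    (continuous_of_discreteTopology.comp (continuous_apply (h + 1))) (continuous_apply h)

theorem isClosed_setOf_isUnit : IsClosed {ξ : AdicInt m | IsUnit ξ} := by
  simp only [isUnit_iff, Set.ofPred_forall]
  refine isClosed_iInter fun h => ?_
  have hc : Continuous fun ξ : AdicInt m => ξ.1 h :=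
    (continuous_apply h).comp continuous_subtype_val
  exact (isClosed_discrete {x : ZMod (m.natAbs ^ h) | IsUnit x}).preimage hc

end AdicInt

/-! ### The limits `BSbar m ξ` and the boundary -/

namespace BaumslagSolitar

variable {m : ℤ}

theorem le_adicInftyFilter_iff {F : Filter ℤ} {ξ : AdicInt m} :
    F ≤ adicInftyFilter m ξ ↔ Tendsto (fun n : ℤ => (n : AdicInt m)) F (𝓝 ξ) ∧
      Tendsto (fun n : ℤ => |n|) F atTop := by
  rw [adicInftyFilter, le_inf_iff, ← tendsto_iff_comap, ← tendsto_iff_comap]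

theorem adicInftyFilter_neBot (hm : m ≠ 0) (ξ : AdicInt m) : (adicInftyFilter m ξ).NeBot := by
  choose r hr using AdicInt.exists_intCast_eq hm ξ
  -- the summand `|m| ^ h * h` makes the sequence unbounded, also when `|m| = 1`
  have hle : map (fun h : ℕ => ((r h + m.natAbs ^ h * h : ℕ) : ℤ)) atTop ≤ adicInftyFilter m ξ := by
    rw [le_adicInftyFilter_iff, tendsto_map'_iff, tendsto_map'_iff]
    constructor
    · refine AdicInt.tendsto_intCast_iff.2 fun i => ?_
      filter_upwards [eventually_ge_atTop i] with h hi
      have h1 : (((r h + m.natAbs ^ h * h : ℕ) : ℤ) : ZMod (m.natAbs ^ h)) = ξ.1 h := by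
        rw [← hr h]
        have : ((m.natAbs ^ h : ℕ) : ZMod (m.natAbs ^ h)) = 0 := ZMod.natCast_self _
        rw [Nat.cast_add, Nat.cast_mul]
        simp only [Int.cast_add, Int.cast_mul, Int.cast_natCast, this, zero_mul, add_zero]
      rw [← AdicInt.castHom_val ξ hi, ← h1, map_intCast]
    · refine tendsto_atTop_mono (f := fun h : ℕ => (h : ℤ)) (fun h => ?_) tendsto_natCast_atTop_atTop
      change (h : ℤ) ≤ |((r h + m.natAbs ^ h * h : ℕ) : ℤ)|
      rw [Nat.abs_cast, Nat.cast_le]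
      have : 1 ≤ m.natAbs ^ h := Nat.one_le_iff_ne_zero.2 (pow_ne_zero _ (Int.natAbs_ne_zero.2 hm))
      nlinarith
  exact NeBot.mono inferInstance hle

theorem isUnitLimitFilter (hm : m ≠ 0) {ξ : AdicInt m} (hξ : IsUnit ξ) :
    IsUnitLimitFilter m (adicInftyFilter m ξ) := by
  obtain ⟨h1, h2⟩ := le_adicInftyFilter_iff.1 (le_refl (adicInftyFilter m ξ))
  rw [AdicInt.tendsto_intCast_iff] at h1
  refine ⟨?_, fun h => ?_, h2⟩
  · filter_upwards [h1 1] with n hn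
    have h3 := AdicInt.isUnit_iff.1 hξ 1
    rw [← hn, ZMod.coe_int_isUnit_iff_isCoprime, pow_one, Int.natCast_natAbs] at h3
    exact (IsCoprime.abs_left_iff _ _).1 h3
  · obtain ⟨r, hr⟩ := AdicInt.exists_intCast_eq hm ξ h
    exact ⟨r, (h1 h).mono fun n hn => AdicInt.intCast_zmod_eq_iff.1 (hn.trans hr.symm)⟩

theorem tendsto_BSbar (hm : m ≠ 0) {ξ : AdicInt m} (hξ : IsUnit ξ) :
    Tendsto (BS m) (adicInftyFilter m ξ) (𝓝 (BSbar m ξ)) := by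
  have := adicInftyFilter_neBot hm ξ
  exact tendsto_nhds_limUnder (exists_tendsto_BS hm (isUnitLimitFilter hm hξ))

theorem eventually_mem_ker_BSbar_iff (hm : m ≠ 0) {ξ : AdicInt m} (hξ : IsUnit ξ)
    (w : FreeGroup (Fin 2)) :
    ∀ᶠ n in adicInftyFilter m ξ, (w ∈ (BS m n).ker ↔ w ∈ (BSbar m ξ).ker) :=
  MarkedGroupSpace.tendsto_nhds_iff_eventually_mem_ker.1 (tendsto_BSbar hm hξ) w

theorem eventually_nhds_eventually_adicInftyFilter {ξ : AdicInt m} {p : ℤ → Prop}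
    (h : ∀ᶠ n in adicInftyFilter m ξ, p n) :
    ∀ᶠ η in 𝓝 ξ, ∀ᶠ n in adicInftyFilter m η, p n := by
  obtain ⟨s, hs, t, ht, hst⟩ := mem_inf_iff.1 h
  filter_upwards [eventually_eventually_nhds.2 (eventually_comap.1 hs)] with η hη
  exact mem_inf_iff.2 ⟨s, eventually_comap.2 hη, t, ht, hst⟩

/-- The triviality of a given word in `BS(m,n)` is constant for `n` in a neighbourhood of `ξ` with
`|n|` large, and this region serves every unit `η` close to `ξ`. -/
theorem continuousOn_BSbar (hm : m ≠ 0) : ContinuousOn (BSbar m) {ξ | IsUnit ξ} := by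
  intro ξ hξ
  refine MarkedGroupSpace.tendsto_nhds_iff_eventually_mem_ker.2 fun w => ?_
  filter_upwards [self_mem_nhdsWithin, nhdsWithin_le_nhds
    (eventually_nhds_eventually_adicInftyFilter (eventually_mem_ker_BSbar_iff hm hξ w))] with η hη h
  have := adicInftyFilter_neBot hm η
  obtain ⟨n, h1, h2⟩ := (h.and (eventually_mem_ker_BSbar_iff hm hη w)).exists
  exact h2.symm.trans h1

/-- If `ξ` and `η` agree modulo `m ^ h` but not modulo `m ^ (h + 1)`, then `congruenceWord m r h`
with `r ≡ ξ` modulo `m ^ (h + 1)` separates the two limits. -/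
theorem injOn_BSbar (hm : m ≠ 0) : Set.InjOn (BSbar m) {ξ | IsUnit ξ} := by
  intro ξ hξ η hη heq
  by_contra hne
  have hex : ∃ h, ξ.1 h ≠ η.1 h := by
    by_contra! hc
    exact hne (Subtype.ext (funext hc))
  classical
  obtain ⟨h, hh⟩ : ∃ h, Nat.find hex = h + 1 := by
    refine Nat.exists_eq_succ_of_ne_zero fun h0 => ?_
    have h1 := Nat.find_spec hex
    rw [h0] at h1
    have : Subsingleton (ZMod (m.natAbs ^ 0)) := by
      rw [pow_zero]
      infer_instance
    exact h1 (Subsingleton.elim _ _)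
  have hsucc : ξ.1 (h + 1) ≠ η.1 (h + 1) := hh ▸ Nat.find_spec hex
  have hpred : ξ.1 h = η.1 h := not_not.1 (Nat.find_min hex (m := h) (by omega))
  obtain ⟨r, hr⟩ := AdicInt.exists_intCast_eq hm ξ (h + 1)
  have hr' : ((r : ℤ) : ZMod (m.natAbs ^ h)) = ξ.1 h := by
    rw [← AdicInt.castHom_val ξ h.le_succ, ← hr, map_intCast]
  have hlim : ∀ ζ : AdicInt m, ∀ i, ∀ᶠ n in adicInftyFilter m ζ,
      ((n : ℤ) : ZMod (m.natAbs ^ i)) = ζ.1 i := fun ζ =>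
    AdicInt.tendsto_intCast_iff.1 (le_adicInftyFilter_iff.1 le_rfl).1
  have hmem : congruenceWord m r h ∈ (BSbar m ξ).ker := by
    have := adicInftyFilter_neBot hm ξ
    obtain ⟨n, h1, h2⟩ := ((eventually_mem_ker_BSbar_iff hm hξ (congruenceWord m r h)).and
      (hlim ξ (h + 1))).exists
    exact h1.1 (congruenceWord_mem_ker_BS (AdicInt.intCast_zmod_eq_iff.1 (h2.trans hr.symm)))
  have := adicInftyFilter_neBot hm η
  have hF := isUnitLimitFilter hm hη
  obtain ⟨n, h1, h2, h3, h4, h5⟩ := ((eventually_mem_ker_BSbar_iff hm hη (congruenceWord m r h)).and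
    ((hlim η (h + 1)).and ((hlim η h).and (hF.eventually_isCoprime.and
      (hF.tendsto_abs.eventually_gt_atTop 1))))).exists
  refine congruenceWord_notMem_ker_BS hm h5 h4 ?_ ?_ (h1.2 (heq ▸ hmem))
  · exact AdicInt.intCast_zmod_eq_iff.1 (h3.trans (hpred.symm.trans hr'.symm))
  · intro hd
    exact hsucc (hr.symm.trans ((AdicInt.intCast_zmod_eq_iff.2 hd).symm.trans h2))

/-- The defining relator of `BS(m,n)` does not survive in `BS(m,n')` for `n' ≠ n`, so `BS(m,n)` is
not a limit of groups `BS(m,n')` with `|n'|` tending to infinity. -/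
theorem BSbar_notMem_coprimeBS (hm : m ≠ 0) {ξ : AdicInt m} (hξ : IsUnit ξ) :
    BSbar m ξ ∉ coprimeBS m := by
  rintro ⟨n, hn, -, heq⟩
  have := adicInftyFilter_neBot hm ξ
  have h := tendsto_BSbar hm hξ
  rw [heq] at h
  have habs := (isUnitLimitFilter hm hξ).tendsto_abs
  obtain ⟨n', h1, h2⟩ := ((eventually_eq_of_tendsto_BS hm hn
    ((habs.eventually_gt_atTop 0).mono fun _ => abs_pos.1) h).and
    (habs.eventually_gt_atTop |n|)).exists
  rw [h1] at h2
  exact lt_irrefl _ h2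

theorem BSbar_mem_derivedSet (hm : m ≠ 0) {ξ : AdicInt m} (hξ : IsUnit ξ) :
    BSbar m ξ ∈ derivedSet (coprimeBS m) := by
  have := adicInftyFilter_neBot hm ξ
  have hF := isUnitLimitFilter hm hξ
  have hmem : ∀ᶠ n in adicInftyFilter m ξ, BS m n ∈ coprimeBS m := by
    filter_upwards [hF.eventually_isCoprime, hF.tendsto_abs.eventually_gt_atTop 0] with n h1 h2
    exact ⟨n, abs_pos.1 h2, h1, rfl⟩
  refine accPt_iff_frequently.2 ((tendsto_BSbar hm hξ).frequently ?_)
  refine (hmem.mono fun n hn => ⟨?_, hn⟩).frequently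
  intro heq
  exact BSbar_notMem_coprimeBS hm hξ (heq ▸ hn)

/-- An ultrafilter on `ℤ` along which `BS(m,n)` tends to an accumulation point is not principal, and
compactness of `ℤ_m` makes it converge to some `ξ`. -/
theorem exists_eq_BSbar_of_mem_derivedSet (hm : m ≠ 0) {G : MarkedGroupSpace 2}
    (hG : G ∈ derivedSet (coprimeBS m)) : ∃ ξ, IsUnit ξ ∧ BSbar m ξ = G := by
  have hfreq : ∃ᶠ H in 𝓝 G, H ≠ G ∧ H ∈ coprimeBS m := accPt_iff_frequently.1 hG
  let S : Set ℤ := {n | BS m n ≠ G ∧ IsCoprime m n}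
  have hne : (comap (BS m) (𝓝 G) ⊓ 𝓟 S).NeBot := by
    rw [← frequently_mem_iff_neBot, frequently_comap]
    refine hfreq.mono ?_
    rintro H ⟨hH, n, hn, hmn, rfl⟩
    exact ⟨n, rfl, hH, hmn⟩
  let U := Ultrafilter.of (comap (BS m) (𝓝 G) ⊓ 𝓟 S)
  have hU : ↑U ≤ comap (BS m) (𝓝 G) ⊓ 𝓟 S := Ultrafilter.of_le _
  have hlim : Tendsto (BS m) U (𝓝 G) := tendsto_iff_comap.2 (hU.trans inf_le_left)
  have hS : ∀ᶠ n in (U : Filter ℤ), n ∈ S := (hU.trans inf_le_right) (mem_principal_self S)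
  have habs : Tendsto (fun n : ℤ => |n|) U atTop := by
    refine tendsto_atTop.2 fun N => ?_
    -- Otherwise `U` is principal at some `n` with `BS(m,n) ≠ G`, against `BS(m,n) → G`.
    by_contra hN
    have hfin : {n : ℤ | ¬ N ≤ |n|}.Finite := (Set.finite_Icc (-N) N).subset fun n hn =>
      abs_le.1 (not_le.1 hn).le
    obtain ⟨n, -, hn⟩ := Ultrafilter.eq_pure_of_finite_mem hfin (Ultrafilter.eventually_not.2 hN)
    rw [hn] at hlim hS
    have hnS : n ∈ S := hS
    have h1 : pure (BS m n) ≤ 𝓝 G := by simpa [Tendsto] using hlim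
    exact hnS.1 (pure_le_nhds_iff.1 h1)
  have := AdicInt.compactSpace hm
  obtain ⟨ξ, -, hξ⟩ := isCompact_univ.ultrafilter_le_nhds
    (U.map fun n : ℤ => (n : AdicInt m)) (by simp)
  have hξu : IsUnit ξ := AdicInt.isUnit_of_tendsto (hS.mono fun n hn => hn.2) hξ
  exact ⟨ξ, hξu, tendsto_nhds_unique
    ((tendsto_BSbar hm hξu).mono_left (le_adicInftyFilter_iff.2 ⟨hξ, habs⟩)) hlim⟩

theorem derivedSet_coprimeBS (hm : m ≠ 0) :
    derivedSet (coprimeBS m) = BSbar m '' {ξ | IsUnit ξ} := by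
  refine Set.Subset.antisymm (fun G hG => exists_eq_BSbar_of_mem_derivedSet hm hG) ?_
  rintro G ⟨ξ, hξ, rfl⟩
  exact BSbar_mem_derivedSet hm hξ

end BaumslagSolitar

open BaumslagSolitar in
theorem corollary2p13 (m : ℤ) (hm : m ≠ 0) :
    -- the limits defining `BSbar m ξ` exist
    (∀ ξ : AdicInt m, IsUnit ξ → ∀ u : ℕ → ℤ,
      Tendsto (fun k => (u k : AdicInt m)) atTop (𝓝 ξ) →
      Tendsto (fun k => |u k|) atTop atTop →
      Tendsto (fun k => BS m (u k)) atTop (𝓝 (BSbar m ξ))) ∧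
    -- the boundary, as the set of accumulation points and as the set of new points of the closure
    derivedSet (coprimeBS m) = BSbar m '' {ξ | IsUnit ξ} ∧
    closure (coprimeBS m) \ coprimeBS m = BSbar m '' {ξ | IsUnit ξ} ∧
    -- the parametrization is a homeomorphism onto the boundary
    ∃ e : {ξ : AdicInt m | IsUnit ξ} ≃ₜ derivedSet (coprimeBS m),
      ∀ ξ, (e ξ : MarkedGroupSpace 2) = BSbar m ξ := by
  have hderiv := derivedSet_coprimeBS hm
  refine ⟨fun ξ hξ u hu habs => ?_, hderiv, ?_, ?_⟩
  · have hle : map u atTop ≤ adicInftyFilter m ξ :=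
      le_adicInftyFilter_iff.2 ⟨tendsto_map'_iff.2 hu, tendsto_map'_iff.2 habs⟩
    exact (tendsto_BSbar hm hξ).comp hle
  · rw [closure_eq_self_union_derivedSet, Set.union_sdiff_left, hderiv, sdiff_eq_left]
    rw [Set.disjoint_left]
    rintro G ⟨ξ, hξ, rfl⟩
    exact BSbar_notMem_coprimeBS hm hξ
  · have := AdicInt.compactSpace hm
    have : CompactSpace {ξ : AdicInt m | IsUnit ξ} :=
      isCompact_iff_compactSpace.1 AdicInt.isClosed_setOf_isUnit.isCompact
    let f : {ξ : AdicInt m | IsUnit ξ} → derivedSet (coprimeBS m) :=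
      fun ξ => ⟨BSbar m ξ, BSbar_mem_derivedSet hm ξ.2⟩
    have hf : Function.Bijective f := by
      refine ⟨fun ξ η h => Subtype.ext
        (injOn_BSbar hm ξ.2 η.2 (congrArg Subtype.val h)), fun G => ?_⟩
      obtain ⟨ξ, hξ, h⟩ := exists_eq_BSbar_of_mem_derivedSet hm G.2
      exact ⟨⟨ξ, hξ⟩, Subtype.ext h⟩
    have hc : Continuous (Equiv.ofBijective f hf) :=
      (continuousOn_iff_continuous_domRestrict.1 (continuousOn_BSbar hm)).subtype_mk _
    exact ⟨hc.homeoOfEquivCompactToT2, fun ξ => rfl⟩
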